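/- **Setting.** Let $B$ be a unital $C^*$-algebra and $(A,B,E)$ a $B$-valued non-commutative probability space: $A\supset B$ is a $C^*$-algebra with the same unit and $E:A\to B$ is a conditional expectation (a positive $B$-bimodule projection onto $B$). An (algebraic) $B$-valued distribution is a $\mathbb C$-linear unital $B$-bimodule map $\mu:B\langle X\rangle\to B$. The distribution of $a\in A$ is $\mu_a[b_0Xb_1X\cdots Xb_n]=E[b_0ab_1a\cdots ab_n]$. For $\lambda_i\in B$, maps $\alpha_i:B\to B$ ($i\ge1$), and a non-crossing partition $\pi$ of the $n$ letters $X$ into singletons and pairs ($\pi\in NC_{1,2}(n)$), let $T_\pi(b_0Xb_1\cdots Xb_n)$ be obtained by replacing each singleton block by $\lambda_d$ and each pair by an application of $\alpha_d$ to the expression between its two letters, where $d$ is the depth of the block (an outer block has depth $1$). The distribution with Jacobi parameters $(\lambda_i),(\alpha_i)$ is $\mu[b_0Xb_1\cdots Xb_n]=\sum_{\pi\in NC_{1,2}(n)}T_\pi(b_0Xb_1\cdots Xb_n)$. The centered Bernoulli distribution with parameter $\alpha$ has $\lambda_i=0$ for all $i$, $\alpha_1=\alpha$, and $\alpha_i=0$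 for $i\ge2$. The free cumulants $R_\mu$ of $\mu$ are defined by $M_\mu(b)=1+R_\mu(bM_\mu(b))$ (as fully matricial formal power series, i.e. as an identity of all multilinear coefficients), where $M_\mu(b)=\sum_{n\ge0}\mu[(Xb)^n]$; $\mu^{\boxplus t}$ is the distribution with $R_{\mu^{\boxplus t}}=t\,R_\mu$. **Proposition.** Let $a\in A$ satisfy $E[a]=0$ and $aBa\subset B$, and put $\alpha(b)=aba$ for $b\in B$. Then: (a) $a$ has the centered Bernoulli distribution with parameter $\alpha$; if moreover $a$ is self-adjoint, $\alpha$ is a completely positive map on $B$. (b) Take all $\lambda_i=0$ and all $\alpha_i=\alpha$. Then for every even $n$ and every non-crossing pair partition $\pi$ of the $n$ letters, $T_\pi(b_0Xb_1\cdots Xb_n)=b_0ab_1\cdots ab_n$; in particular it does not depend on $\pi$. (c) For every real $t\ge1$, the distribution $\mu_a^{\boxplus t}$ exists and is unique; its odd moments vanish, $\mu_a^{\boxplus t}[b_0X\cdots Xb_n]=0$ for $n$ odd, and for all $n\ge0$ $$\mu_a^{\boxplus t}[b_0Xb_1\cdots Xb_{2n}]=m_n(t)\,b_0ab_1\cdots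 ab_{2n},$$ where $$m_n(t)=t^{2n}-\frac t2\sum_{k=1}^n\frac1{2k-1}\binom{2k}{k}(t-1)^k\,t^{2(n-k)}.$$ In particular $m_n(2)=\binom{2n}{n}$. -/

import Mathlib

open scoped CStarAlgebra

namespace OpFree

noncomputable section

/-! ### Algebraic `B`-valued non-commutative distributions -/

/-- An algebraic non-commutative distribution over `B`: a `ℂ`-linear, unital, `B`-bimodule map
`μ : B⟨X⟩ → B`. Since `B⟨X⟩` is, as a vector space, the direct sum over `n` of the `(n + 1)`-fold
tensor powers of `B` (the monomials `b₀ X b₁ X ⋯ X bₙ`), a linear map on `B⟨X⟩` is the family of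
the multilinear maps `mom n b = μ[b₀ X b₁ X ⋯ X bₙ]`. -/
@[ext]
structure AlgDist (B : Type*) [Ring B] [Algebra ℂ B] where
  mom : (n : ℕ) → MultilinearMap ℂ (fun _ : Fin (n + 1) => B) B
  mom_one : mom 0 (fun _ => 1) = 1
  mom_left : ∀ (n : ℕ) (b : Fin (n + 1) → B) (x : B),
    mom n (Function.update b 0 (x * b 0)) = x * mom n b
  mom_right : ∀ (n : ℕ) (b : Fin (n + 1) → B) (y : B),
    mom n (Function.update b (Fin.last n) (b (Fin.last n) * y)) = mom n b * y

/-! ### Free cumulants and free convolution powers -/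

section Cumulants

variable {B : Type*} [Ring B] [Algebra ℂ B]

/-- `μ[b₁ X b₂ X ⋯ X bₘ]` for a word with `m ≥ 1` coefficients (the value at `m = 0` is not
used). -/
def AlgDist.wordMoment (μ : AlgDist B) : (m : ℕ) → (Fin m → B) → B
  | 0, _ => 1
  | m + 1, b => μ.mom m b

/-- `R` is the family of free cumulants `R n (b₁, …, bₙ) = R_μ[X b₁ X b₂ ⋯ X bₙ]` of `μ`, that is,
`M_μ(b) = 1 + R_μ(b M_μ(b))` as non-commutative (fully matricial) formal power series, where
`M_μ(b) = ∑ₙ μ[(X b)ⁿ]`. Comparing multilinear coefficients of degree `n ≥ 1`, this says that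
`μ[X b₁ X b₂ ⋯ X bₙ]` is the sum, over all ways to cut `b₁, …, bₙ` into `k ≥ 1` consecutive
non-empty words `w₁, …, w_k`, of `R k (g₁, …, g_k)` with `g_r` the value of `μ` on the
word `w_r` with letters `X` placed between its coefficients. -/
def IsFreeCumulant (μ : AlgDist B) (R : (n : ℕ) → MultilinearMap ℂ (fun _ : Fin n => B) B) :
    Prop :=
  R 0 = 0 ∧ ∀ (n : ℕ), 0 < n → ∀ b : Fin n → B,
    μ.mom n (Fin.cons 1 b) =
      ∑ c : Composition n, R c.length
        (fun r => μ.wordMoment (c.blocksFun r) (fun i => b (c.embedding r i)))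

/-- `ν = μ^{⊞ t}`: the free cumulants of `ν` are `t` times those of `μ`. -/
def IsFreeConvPower (μ : AlgDist B) (t : ℝ) (ν : AlgDist B) : Prop :=
  ∃ R : (n : ℕ) → MultilinearMap ℂ (fun _ : Fin n => B) B,
    IsFreeCumulant μ R ∧ IsFreeCumulant ν (fun n => (t : ℂ) • R n)

end Cumulants

/-! ### Non-crossing partitions and Jacobi parameters -/

/-- A partition of `{0, …, n - 1}` is non-crossing. -/
def IsNoncrossing {n : ℕ} (π : Finpartition (Finset.range n)) : Prop :=
  ∀ U ∈ π.parts, ∀ V ∈ π.parts, ∀ i j k l : ℕ,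
    i ∈ U → j ∈ V → k ∈ U → l ∈ V → i < j → j < k → k < l → U = V

open Classical in
/-- `NC_{1,2}(n)`: non-crossing partitions all of whose blocks are singletons or pairs. -/
def ncOneTwo (n : ℕ) : Finset (Finpartition (Finset.range n)) :=
  Finset.univ.filter fun π => IsNoncrossing π ∧ ∀ U ∈ π.parts, U.card = 1 ∨ U.card = 2

open Classical in
/-- `NC_2(n)`: non-crossing pair partitions. -/
def ncPair (n : ℕ) : Finset (Finpartition (Finset.range n)) :=
  Finset.univ.filter fun π => IsNoncrossing π ∧ ∀ U ∈ π.parts, U.card = 2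

section Jacobi

variable {B : Type*} [Ring B]

/-- Evaluation of the segment `b_i X_i b_{i+1} X_{i+1} ⋯ X_{j-1} b_j`, all of whose blocks that are
outermost in the segment are nested inside `d` further blocks of `π`, so that they have depth
`d + 1`. The sequences are indexed from `0`: `lam d` and `alp d` belong to blocks of depth `d + 1`.
If the block of `X_i` is a singleton, `X_i` is replaced by `lam d`; if it is a pair `{i, k}`,
`alp d` is applied to the value of the segment strictly between `X_i` and `X_k`. The last branch
does not occur for partitions in `NC_{1,2}`. -/
def jacobiSegment {n : ℕ} (lam : ℕ → B) (alp : ℕ → B → B) (π : Finpartition (Finset.range n))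
    (b : ℕ → B) (d i j : ℕ) : B :=
  if i < j then
    if (π.part i).sup id = i then
      b i * lam d * jacobiSegment lam alp π b d (i + 1) j
    else if i < (π.part i).sup id ∧ (π.part i).sup id < j then
      b i * alp d (jacobiSegment lam alp π b (d + 1) (i + 1) ((π.part i).sup id)) *
        jacobiSegment lam alp π b d ((π.part i).sup id + 1) j
    else 0
  else b j
termination_by j - i
decreasing_by all_goals omega

/-- `T_π(b₀ X b₁ X ⋯ X bₙ)` for the sequences `(lam, alp)`, where the letters `X` are numbered
`0, …, n - 1` from left to right. -/
def jacobiTerm {n : ℕ} (lam : ℕ → B) (alp : ℕ → B → B) (π : Finpartition (Finset.range n))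
    (b : Fin (n + 1) → B) : B :=
  jacobiSegment lam alp π (fun i => b (Fin.ofNat (n + 1) i)) 0 0 n

variable [Algebra ℂ B]

/-- `μ` is the Jacobi–Szegő distribution with Jacobi parameters
`(λ₁, λ₂, …; α₁, α₂, …) = (lam 0, lam 1, …; alp 0, alp 1, …)`. -/
def HasJacobiParameters (μ : AlgDist B) (lam : ℕ → B) (alp : ℕ → B → B) : Prop :=
  ∀ (n : ℕ) (b : Fin (n + 1) → B), μ.mom n b = ∑ π ∈ ncOneTwo n, jacobiTerm lam alp π b

/-- The centered `B`-valued Bernoulli distribution with parameter (covariance) `α`: the Jacobi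
parameters are `(0, 0, 0, …; α, 0, 0, …)`. -/
def IsCenteredBernoulli (μ : AlgDist B) (α : B → B) : Prop :=
  HasJacobiParameters μ (fun _ => 0) (fun d => if d = 0 then α else fun _ => 0)

end Jacobi

/-! ### Non-commutative probability spaces over `B` -/

section Monomial

variable {A B : Type*} [CStarAlgebra A] [CStarAlgebra B]

/-- The element `b₀ a b₁ a ⋯ a bₙ` of `A`, as a multilinear function of `b₀, …, bₙ`. -/
def ncMonomial (ι : B →⋆ₐ[ℂ] A) (a : A) (n : ℕ) :
    MultilinearMap ℂ (fun _ : Fin (n + 1) => B) A :=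
  (MultilinearMap.mkPiAlgebraFin ℂ (n + 1) A).compLinearMap
    (Fin.cases ι.toAlgHom.toLinearMap
      (fun _ => (LinearMap.mulLeft ℂ a).comp ι.toAlgHom.toLinearMap))

theorem ncMonomial_apply (ι : B →⋆ₐ[ℂ] A) (a : A) (n : ℕ) (b : Fin (n + 1) → B) :
    ncMonomial ι a n b = ι (b 0) * (List.ofFn fun i : Fin n => a * ι (b i.succ)).prod := by
  simp [ncMonomial, List.ofFn_succ]

theorem ncMonomial_snoc (ι : B →⋆ₐ[ℂ] A) (a : A) (n : ℕ) (b : Fin (n + 2) → B) :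
    ncMonomial ι a (n + 1) b =
      ncMonomial ι a n (fun i => b i.castSucc) * (a * ι (b (Fin.last (n + 1)))) := by
  rw [ncMonomial_apply, ncMonomial_apply, List.ofFn_succ']
  simp [mul_assoc]

theorem ncMonomial_left (ι : B →⋆ₐ[ℂ] A) (a : A) (n : ℕ) (b : Fin (n + 1) → B) (x : B) :
    ncMonomial ι a n (Function.update b 0 (x * b 0)) = ι x * ncMonomial ι a n b := by
  simp [ncMonomial_apply, mul_assoc]

theorem ncMonomial_right (ι : B →⋆ₐ[ℂ] A) (a : A) (n : ℕ) (b : Fin (n + 1) → B) (y : B) :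
    ncMonomial ι a n (Function.update b (Fin.last n) (b (Fin.last n) * y)) =
      ncMonomial ι a n b * ι y := by
  cases n with
  | zero => simp [ncMonomial_apply]
  | succ n => simp [ncMonomial_snoc, mul_assoc, (Fin.castSucc_lt_last _).ne]

end Monomial

section Space

variable {A B : Type*} [CStarAlgebra A] [PartialOrder A] [StarOrderedRing A]
  [CStarAlgebra B] [PartialOrder B] [StarOrderedRing B]

/-- `(A, B, E)` is an operator-valued non-commutative probability space: `B` is a unital
`C*`-subalgebra of `A` through `ι` (which is injective by `E_ι`), and `E : A → B` is a conditional
expectation, i.e. a positive `B`-bimodule projection onto `B`. -/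
structure IsCondExpectation (ι : B →⋆ₐ[ℂ] A) (E : A →ₗ[ℂ] B) : Prop where
  E_ι : ∀ b, E (ι b) = b
  bimodule : ∀ (x y : B) (z : A), E (ι x * z * ι y) = x * E z * y
  nonneg : ∀ z : A, 0 ≤ z → 0 ≤ E z

/-- The distribution `μ_a[b₀ X b₁ X ⋯ X bₙ] = E[b₀ a b₁ a ⋯ a bₙ]` of `a`. -/
def distribution (ι : B →⋆ₐ[ℂ] A) (E : A →ₗ[ℂ] B) (hE : IsCondExpectation ι E) (a : A) :
    AlgDist B where
  mom n := E.compMultilinearMap (ncMonomial ι a n)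
  mom_one := by simpa [ncMonomial_apply] using hE.E_ι 1
  mom_left n b x := by
    have h := hE.bimodule x 1 (ncMonomial ι a n b)
    simpa [ncMonomial_left] using h
  mom_right n b y := by
    have h := hE.bimodule 1 y (ncMonomial ι a n b)
    simpa [ncMonomial_right] using h

end Space

/-- `m_n(t) = t^{2n} - (t / 2) ∑_{k=1}^n (1 / (2k - 1)) C(2k, k) (t - 1)^k t^{2(n - k)}`. -/
def freeBinomialMoment (n : ℕ) (t : ℝ) : ℝ :=
  t ^ (2 * n) - t / 2 * ∑ k ∈ Finset.Icc 1 n,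
    1 / (2 * (k : ℝ) - 1) * ((2 * k).choose k : ℝ) * (t - 1) ^ k * t ^ (2 * (n - k))

end

end OpFree

namespace OpFree

/-! Since $aBa\subset B$, every word $b_0ab_1\cdots ab_{2n}$ already lies in $B$, so $E$ fixes it; a
word with an odd number of letters is an element of $B$ times $ab$, and is killed by $E[a]=0$
(`ι_distribution_even`, `distribution_odd`). Thus the even moments of $a$ are plain products in $A$.
For (a), a Bernoulli term survives only if no pair encloses a letter, which leaves the single
partition into adjacent pairs. For (b), replacing a pair by $\alpha(x)=axa$ puts its two letters
back, whatever the nesting. For (c), moments nested inside a moment collapse to one moment when all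
blocks have odd size (`distribution_composition`). With the ansatz $\nu=c_n\mu_a$ and
$R=t\rho_n\mu_a$ in degree $n$, the operator-valued moment–cumulant formula becomes the scalar
equation $N=1+t\rho(zN)$, where $N=\sum c_nz^n$ and $\rho+\rho^2=z^2$. A Catalan recursion for
$m_n(t)$ shows that $c_{2n}=m_n(t)$ with zero odd terms solves it (`symmetricMomentSeries_eq`).
Uniqueness holds because moments and cumulants determine each other degree by degree. -/

/-! ### Sums over compositions as coefficients of substituted power series. -/

/-- Compositions with $k$ parts are the $k$-tuples of positive integers with sum $n$; the tuples
with a zero entry, also present in $W^k$, contribute nothing because $W$ has no constant term. -/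
theorem sum_composition_length_eq_coeff_pow {R : Type*} [CommRing R] (W : PowerSeries R)
    (hW : PowerSeries.coeff 0 W = 0) (n k : ℕ) :
    ∑ c : Composition n with c.length = k, ∏ i, PowerSeries.coeff (c.blocksFun i) W =
      PowerSeries.coeff n (W ^ k) := by
  have hpow : W ^ k = ∏ _j : Fin k, W := by simp
  rw [hpow, PowerSeries.coeff_prod]
  refine Finset.sum_bij_ne_zero
    (fun c hc _ => Finsupp.equivFunOnFinite.symm
      (fun i : Fin k => c.blocksFun (Fin.cast (Finset.mem_filter.1 hc).2.symm i))) ?_ ?_ ?_ ?_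
  · intro c hc _
    obtain rfl := (Finset.mem_filter.1 hc).2
    simp [c.sum_blocksFun]
  · intro c hc _ c' hc' _ h
    obtain rfl := (Finset.mem_filter.1 hc).2
    have h2 := (Finset.mem_filter.1 hc').2
    have h' := Finsupp.equivFunOnFinite.symm.injective h
    ext1
    apply List.ext_get
    · rw [c.blocks_length, c'.blocks_length, h2]
    · intro i h1 _
      exact congrFun h' ⟨i, c.blocks_length ▸ h1⟩
  · intro l hl hne
    have hsum : ∑ i, l i = n := by simpa using hl
    have hpos : ∀ i, 0 < l i := by
      intro i
      rcases Nat.eq_zero_or_pos (l i) with h0 | h0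
      · exact absurd (Finset.prod_eq_zero (Finset.mem_univ i) (by rw [h0, hW])) hne
      · exact h0
    let c : Composition n :=
      ⟨List.ofFn l, by
        intro i hi
        obtain ⟨j, rfl⟩ := (List.mem_ofFn' _ _).1 hi
        exact hpos j, by rw [List.sum_ofFn, hsum]⟩
    have hc : c.length = k := by simp [c, Composition.length]
    have hb : ∀ i : Fin k, c.blocksFun (Fin.cast hc.symm i) = l i := by
      intro i
      simp [c, Composition.blocksFun]
    refine ⟨c, by simp [hc], ?_, ?_⟩
    · rw [← Fintype.prod_equiv (finCongr hc.symm) (fun i => PowerSeries.coeff (l i) W) _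
        (fun i => by rw [← hb i]; rfl)]
      exact hne
    · ext i
      exact hb i
  · intro c hc _
    obtain rfl := (Finset.mem_filter.1 hc).2
    rfl

theorem sum_composition_eq_coeff_subst {R : Type*} [CommRing R] (ρ W : PowerSeries R)
    (hW : PowerSeries.constantCoeff W = 0) (n : ℕ) :
    ∑ c : Composition n, PowerSeries.coeff c.length ρ *
        ∏ i, PowerSeries.coeff (c.blocksFun i) W =
      PowerSeries.coeff n (ρ.subst W) := by
  rw [PowerSeries.coeff_subst' (PowerSeries.HasSubst.of_constantCoeff_zero' hW)]
  rw [finsum_eq_sum_of_support_subset (s := Finset.range (n + 1))]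
  · rw [← Finset.sum_fiberwise_of_maps_to (s := Finset.univ) (t := Finset.range (n + 1))
      (g := fun c : Composition n => c.length)
      (fun c _ => Finset.mem_range.2 (Nat.lt_succ_of_le c.length_le))]
    refine Finset.sum_congr rfl fun k _ => ?_
    rw [← sum_composition_length_eq_coeff_pow W (by simpa using hW) n k, smul_eq_mul,
      Finset.mul_sum]
    refine Finset.sum_congr rfl fun c hc => ?_
    obtain rfl := (Finset.mem_filter.1 hc).2
    rfl
  -- $W^k$ has order at least $k$, so powers beyond $n$ do not reach the coefficient of degree $n$.
  · intro k hk
    by_contra hkn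
    apply hk
    have hlt : n < k := by simpa using hkn
    change PowerSeries.coeff k ρ • PowerSeries.coeff n (W ^ k) = 0
    rw [PowerSeries.coeff_of_lt_order n, smul_zero]
    refine lt_of_lt_of_le (Nat.cast_lt.2 hlt) ?_
    exact PowerSeries.le_order_pow_of_constantCoeff_eq_zero k hW

/-! ### Scalar generating functions of cumulants and moments. -/

noncomputable section

/-- The Catalan generating function `C(y) = 1 + y C(y)²` with real coefficients. -/
def catalanReal : PowerSeries ℝ := PowerSeries.catalanSeries.map (Nat.castRingHom ℝ)

theorem catalanReal_eq : catalanReal = 1 + PowerSeries.X * catalanReal ^ 2 := by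
  have h := congrArg (PowerSeries.map (Nat.castRingHom ℝ))
    PowerSeries.catalanSeries_sq_mul_X_add_one
  simp only [map_add, map_mul, map_pow, PowerSeries.map_X, map_one] at h
  rw [add_comm, mul_comm]
  exact h.symm

/-- The generating function `R(z) = (√(1 + 4 z²) - 1) / 2` of the free cumulants of the symmetric
Bernoulli distribution. -/
def bernoulliCumulant : PowerSeries ℝ :=
  PowerSeries.X ^ 2 *
    PowerSeries.expand 2 two_ne_zero (PowerSeries.rescale (-1) catalanReal)

/-- This is $C=1+yC^2$ at $y=-z^2$, multiplied by $z^2$. -/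
theorem bernoulliCumulant_add_sq :
    bernoulliCumulant + bernoulliCumulant ^ 2 = PowerSeries.X ^ 2 := by
  have h := congrArg (fun f => PowerSeries.expand 2 two_ne_zero (PowerSeries.rescale (-1 : ℝ) f))
    catalanReal_eq
  simp only [map_add, map_mul, map_pow, map_one, PowerSeries.rescale_X, PowerSeries.expand_X,
    map_neg] at h
  rw [bernoulliCumulant]
  linear_combination PowerSeries.X ^ 2 * h

theorem constantCoeff_bernoulliCumulant : PowerSeries.constantCoeff bernoulliCumulant = 0 := by
  simp [bernoulliCumulant]

theorem freeBinomialMoment_zero (t : ℝ) : freeBinomialMoment 0 t = 1 := by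
  simp [freeBinomialMoment]

/-- Only the summand $k=n+1$ is new, and $\frac1{2k-1}\binom{2k}{k}=2C_{k-1}$ with $C_j$ the Catalan
numbers. -/
theorem freeBinomialMoment_succ (n : ℕ) (t : ℝ) :
    freeBinomialMoment (n + 1) t = t ^ 2 * freeBinomialMoment n t -
      t * (t - 1) ^ (n + 1) * catalan n := by
  have hcat : (1 : ℝ) / (2 * ((n + 1 : ℕ) : ℝ) - 1) * ((2 * (n + 1)).choose (n + 1) : ℝ) =
      2 * catalan n := by
    have h1 : ((n : ℝ) + 1) * ((n + 1).centralBinom : ℝ) =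
        2 * (2 * n + 1) * (n.centralBinom : ℝ) := by
      exact_mod_cast Nat.succ_mul_centralBinom_succ n
    have h2 : ((n : ℝ) + 1) * (catalan n : ℝ) = (n.centralBinom : ℝ) := by
      exact_mod_cast succ_mul_catalan_eq_centralBinom n
    rw [← h2] at h1
    rw [← Nat.centralBinom_eq_two_mul_choose]
    have h3 : ((n : ℝ) + 1) ≠ 0 := by positivity
    have h4 : (2 * ((n + 1 : ℕ) : ℝ) - 1) ≠ 0 := by
      push_cast; have : (0 : ℝ) ≤ n := n.cast_nonneg
      intro h; linarith
    have h5 : ((n + 1).centralBinom : ℝ) = 2 * (2 * n + 1) * catalan n := by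
      apply mul_left_cancel₀ h3; linarith
    rw [h5]; field_simp; push_cast; ring
  rw [freeBinomialMoment, freeBinomialMoment, Finset.sum_Icc_succ_top (by omega), hcat]
  have hs : ∑ k ∈ Finset.Icc 1 n, 1 / (2 * (k : ℝ) - 1) * ((2 * k).choose k : ℝ) *
        (t - 1) ^ k * t ^ (2 * (n + 1 - k)) =
      t ^ 2 * ∑ k ∈ Finset.Icc 1 n, 1 / (2 * (k : ℝ) - 1) * ((2 * k).choose k : ℝ) *
        (t - 1) ^ k * t ^ (2 * (n - k)) := by
    rw [Finset.mul_sum]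
    refine Finset.sum_congr rfl fun k hk => ?_
    rw [show 2 * (n + 1 - k) = 2 * (n - k) + 2 by
      have := (Finset.mem_Icc.1 hk).2; omega, pow_add]
    ring
  rw [hs]
  simp only [Nat.sub_self, mul_zero, pow_zero]
  ring

theorem freeBinomialMoment_one (n : ℕ) : freeBinomialMoment n 1 = 1 := by
  induction n with
  | zero => exact freeBinomialMoment_zero 1
  | succ n ih => simp [freeBinomialMoment_succ, ih]

theorem freeBinomialMoment_two (n : ℕ) : freeBinomialMoment n 2 = ((2 * n).choose n : ℝ) := by
  rw [← Nat.centralBinom_eq_two_mul_choose]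
  induction n with
  | zero => simp [freeBinomialMoment_zero]
  | succ n ih =>
    have h1 : ((n : ℝ) + 1) * ((n + 1).centralBinom : ℝ) =
        2 * (2 * n + 1) * (n.centralBinom : ℝ) := by
      exact_mod_cast Nat.succ_mul_centralBinom_succ n
    have h2 : ((n : ℝ) + 1) * (catalan n : ℝ) = (n.centralBinom : ℝ) := by
      exact_mod_cast succ_mul_catalan_eq_centralBinom n
    have h3 : ((n : ℝ) + 1) ≠ 0 := by positivity
    rw [freeBinomialMoment_succ, ih]
    apply mul_left_cancel₀ h3
    rw [h1]
    norm_num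
    linear_combination (-2 : ℝ) * h2

/-- The generating function of `m_n(t)`. -/
def momentSeries (t : ℝ) : PowerSeries ℝ := PowerSeries.mk fun n => freeBinomialMoment n t

theorem momentSeries_mul (t : ℝ) :
    momentSeries t * (1 - PowerSeries.C (t ^ 2) * PowerSeries.X) =
      1 - PowerSeries.C (t * (t - 1)) * PowerSeries.X *
        PowerSeries.rescale (t - 1) catalanReal := by
  ext n
  cases n with
  | zero => simp [momentSeries, freeBinomialMoment_zero]
  | succ n =>
    have e1 : momentSeries t * (1 - PowerSeries.C (t ^ 2) * PowerSeries.X) =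
      momentSeries t - PowerSeries.C (t ^ 2) * momentSeries t * PowerSeries.X := by ring
    have e2 : PowerSeries.C (t * (t - 1)) * PowerSeries.X *
        PowerSeries.rescale (t - 1) catalanReal = PowerSeries.C (t * (t - 1)) *
        PowerSeries.rescale (t - 1) catalanReal * PowerSeries.X := by ring
    rw [e1, e2]
    simp only [map_sub, PowerSeries.coeff_succ_mul_X, PowerSeries.coeff_C_mul,
      PowerSeries.coeff_one, PowerSeries.coeff_rescale, momentSeries, PowerSeries.coeff_mk,
      catalanReal, PowerSeries.coeff_map, PowerSeries.catalanSeries_coeff,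
      freeBinomialMoment_succ]
    simp
    ring

/-- After multiplication by $1-t^2x$ this is a quadratic equation in $M(1-t^2x)$, which
`momentSeries_mul` expresses through $D(x)=C((t-1)x)$; it then follows from $D=1+(t-1)xD^2$. -/
theorem momentSeries_quadratic (t : ℝ) :
    (momentSeries t - 1) ^ 2 + PowerSeries.C t * (momentSeries t - 1) =
      PowerSeries.C (t ^ 2) * PowerSeries.X * momentSeries t ^ 2 := by
  have hM := momentSeries_mul t
  have hD := congrArg (PowerSeries.rescale (t - 1)) catalanReal_eq
  simp only [map_add, map_mul, map_pow, map_one, PowerSeries.rescale_X, map_sub] at hD hM ⊢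
  have hne : (1 - PowerSeries.C t ^ 2 * PowerSeries.X : PowerSeries ℝ) ≠ 0 := by
    intro h
    simpa using congrArg PowerSeries.constantCoeff h
  refine mul_right_cancel₀ hne ?_
  set T : PowerSeries ℝ := PowerSeries.C t
  set M := momentSeries t
  set D := PowerSeries.rescale (t - 1) catalanReal
  set x : PowerSeries ℝ := PowerSeries.X
  linear_combination (M * (1 - T ^ 2 * x) + (1 - T * (T - 1) * x * D) + (T - 2)) * hM
    - T ^ 2 * (T - 1) * x * hD

/-- The generating function `∑ c_n zⁿ` of all moments, with `c_{2n} = m_n(t)` and vanishing odd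
moments. -/
def symmetricMomentSeries (t : ℝ) : PowerSeries ℝ :=
  PowerSeries.expand 2 two_ne_zero (momentSeries t)

theorem coeff_symmetricMomentSeries_even (t : ℝ) (n : ℕ) :
    PowerSeries.coeff (2 * n) (symmetricMomentSeries t) = freeBinomialMoment n t := by
  simp [symmetricMomentSeries, momentSeries]

theorem coeff_symmetricMomentSeries_odd (t : ℝ) (n : ℕ) (hn : Odd n) :
    PowerSeries.coeff n (symmetricMomentSeries t) = 0 :=
  PowerSeries.coeff_expand_of_not_dvd _ _ _ hn.not_two_dvd_nat

theorem symmetricMomentSeries_eq (t : ℝ) (ht : t ≠ 0) :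
    symmetricMomentSeries t = 1 + PowerSeries.C t *
      bernoulliCumulant.subst (PowerSeries.X * symmetricMomentSeries t) := by
  set N := symmetricMomentSeries t with hN
  have hq := congrArg (PowerSeries.expand 2 two_ne_zero) (momentSeries_quadratic t)
  simp only [map_add, map_mul, map_pow, map_one, map_sub, PowerSeries.expand_C,
    PowerSeries.expand_X] at hq
  rw [← symmetricMomentSeries, ← hN] at hq
  have hW : PowerSeries.constantCoeff (PowerSeries.X * N) = 0 := by simp
  have hs : PowerSeries.HasSubst (PowerSeries.X * N) :=
    PowerSeries.HasSubst.of_constantCoeff_zero' hW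
  have hR := congrArg (PowerSeries.subst (PowerSeries.X * N)) bernoulliCumulant_add_sq
  rw [PowerSeries.subst_add hs, PowerSeries.subst_pow hs, PowerSeries.subst_pow hs,
    PowerSeries.subst_X hs] at hR
  have hR0 : PowerSeries.constantCoeff (bernoulliCumulant.subst (PowerSeries.X * N)) = 0 :=
    PowerSeries.constantCoeff_subst_eq_zero hW _ constantCoeff_bernoulliCumulant
  have hN0 : PowerSeries.constantCoeff N = 1 := by
    have := coeff_symmetricMomentSeries_even t 0
    simpa [freeBinomialMoment_zero] using this
  set Q := bernoulliCumulant.subst (PowerSeries.X * N)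
  set T : PowerSeries ℝ := PowerSeries.C t
  -- Both $N-1$ and $tQ$ are roots of $Y^2+tY=t^2z^2N^2$. The second factor has constant term
  -- $t\ne0$, so the first one vanishes.
  have hprod : (N - 1 - T * Q) * (N - 1 + T * Q + T) = 0 := by
    linear_combination hq - T ^ 2 * hR
  rcases mul_eq_zero.1 hprod with h | h
  · linear_combination h
  · exact absurd (by simpa [hN0, hR0, T] using congrArg PowerSeries.constantCoeff h) ht

/-- The scalar moment–cumulant formula for the free convolution powers of the symmetric Bernoulli
distribution. -/
theorem coeff_symmetricMomentSeries_eq_sum (t : ℝ) (ht : t ≠ 0) (n : ℕ) (hn : 0 < n) :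
    PowerSeries.coeff n (symmetricMomentSeries t) =
      ∑ c : Composition n, t * PowerSeries.coeff c.length bernoulliCumulant *
        ∏ i, PowerSeries.coeff (c.blocksFun i - 1) (symmetricMomentSeries t) := by
  conv_lhs => rw [symmetricMomentSeries_eq t ht]
  rw [map_add, PowerSeries.coeff_C_mul, PowerSeries.coeff_one, if_neg hn.ne', zero_add,
    ← sum_composition_eq_coeff_subst _ _ (by simp), Finset.mul_sum]
  refine Finset.sum_congr rfl fun c _ => ?_
  rw [mul_assoc]
  congr 2
  refine Finset.prod_congr rfl fun i _ => ?_
  obtain ⟨m, hm⟩ := Nat.exists_eq_add_of_le' (c.one_le_blocksFun i)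
  rw [hm, mul_comm, PowerSeries.coeff_succ_mul_X, Nat.add_sub_cancel]

end

/-! ### The moment–cumulant formula over $B$: uniqueness and reduction to scalars. -/

section

variable {B : Type*} [Ring B] [Algebra ℂ B]

theorem AlgDist.mom_zero_apply (μ : AlgDist B) (b : Fin 1 → B) : μ.mom 0 b = b 0 := by
  have h := μ.mom_left 0 (fun _ => 1) (b 0)
  rw [μ.mom_one, mul_one] at h
  refine Eq.trans ?_ h
  congr 1
  ext i
  fin_cases i
  simp

theorem AlgDist.mom_eq_mul (μ : AlgDist B) (n : ℕ) (b : Fin (n + 1) → B) :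
    μ.mom n b = b 0 * μ.mom n (Fin.cons 1 (Fin.tail b)) := by
  rw [← μ.mom_left]
  congr 1
  rw [Fin.cons_zero, mul_one, Fin.update_cons_zero, Fin.cons_self_tail]

theorem AlgDist.wordMoment_ones (μ : AlgDist B) {n : ℕ} (b : Fin n → B)
    (r : Fin (Composition.ones n).length) :
    μ.wordMoment ((Composition.ones n).blocksFun r)
        (fun i => b ((Composition.ones n).embedding r i)) =
      b (Fin.cast (Composition.ones_length n) r) := by
  have key : ∀ (m : ℕ) (hm : m = 1) (w : Fin m → B), μ.wordMoment m w = w ⟨0, by omega⟩ := by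
    rintro _ rfl w
    exact μ.mom_zero_apply w
  rw [key _ (Composition.ones_blocksFun n r)]
  congr 1
  rw [Composition.ones_embedding r (by simp)]
  rfl

theorem multilinear_cast {B : Type*} [AddCommMonoid B] [Module ℂ B]
    (R : (n : ℕ) → MultilinearMap ℂ (fun _ : Fin n => B) B) {k n : ℕ} (h : k = n) (b : Fin n → B) :
    R k (fun r => b (Fin.cast h r)) = R n b := by
  subst h
  rfl

theorem IsFreeCumulant.unique {μ : AlgDist B}
    {R R' : (n : ℕ) → MultilinearMap ℂ (fun _ : Fin n => B) B}
    (h : IsFreeCumulant μ R) (h' : IsFreeCumulant μ R') : R = R' := by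
  funext n
  induction n using Nat.strong_induction_on with
  | _ n ih =>
  rcases Nat.eq_zero_or_pos n with rfl | hn
  · rw [h.1, h'.1]
  ext b
  have e := (h.2 n hn b).symm.trans (h'.2 n hn b)
  -- The composition into ones contributes the $n$-th cumulant of $b$ itself; every other
  -- composition is shorter and falls under the induction hypothesis.
  rw [← Finset.add_sum_erase _ _ (Finset.mem_univ (Composition.ones n)),
    ← Finset.add_sum_erase (a := Composition.ones n) _ _ (Finset.mem_univ _)] at e
  have e2 := Finset.sum_congr (rfl : Finset.univ.erase (Composition.ones n) = _)
    (fun c hc => by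
      have hlt : c.length < n := lt_of_le_of_ne c.length_le fun hl =>
        (Finset.mem_erase.1 hc).1 (Composition.eq_ones_iff_length.2 hl)
      exact congrArg (fun S => S fun r => μ.wordMoment (c.blocksFun r)
        (fun i => b (c.embedding r i))) (ih _ hlt))
  rw [e2] at e
  have e3 := add_right_cancel e
  simp only [μ.wordMoment_ones] at e3
  rwa [multilinear_cast R, multilinear_cast R'] at e3

theorem IsFreeCumulant.dist_unique {μ ν : AlgDist B}
    {R : (n : ℕ) → MultilinearMap ℂ (fun _ : Fin n => B) B}
    (h : IsFreeCumulant μ R) (h' : IsFreeCumulant ν R) : μ = ν := by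
  ext1
  funext n
  induction n using Nat.strong_induction_on with
  | _ n ih =>
  ext b
  rcases Nat.eq_zero_or_pos n with rfl | hn
  · rw [μ.mom_zero_apply, ν.mom_zero_apply]
  rw [μ.mom_eq_mul, ν.mom_eq_mul, h.2 n hn, h'.2 n hn]
  congr 1
  refine Finset.sum_congr rfl fun c _ => ?_
  congr 1
  funext r
  -- A block of $m\le n$ coefficients carries $m-1<n$ letters, so only lower moments occur on the
  -- right.
  have hle := c.blocksFun_le r
  have hpos := c.one_le_blocksFun r
  generalize (fun i => Fin.tail b (c.embedding r i)) = w
  revert w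
  generalize c.blocksFun r = m at hle hpos
  intro w
  cases m with
  | zero => rfl
  | succ m => exact congrArg (fun S => S w) (ih m hle)

theorem existsUnique_isFreeConvPower {μ ν : AlgDist B} {t : ℝ} (h : IsFreeConvPower μ t ν) :
    ∃! ν : AlgDist B, IsFreeConvPower μ t ν := by
  refine ⟨ν, h, ?_⟩
  rintro ν' ⟨R', h1', h2'⟩
  obtain ⟨R, h1, h2⟩ := h
  obtain rfl := h1.unique h1'
  exact h2'.dist_unique h2

/-- The distribution whose `n`-th moments are those of `μ` multiplied by the scalar `c n`. -/
noncomputable def AlgDist.scaleMoments (μ : AlgDist B) (c : ℕ → ℂ) (hc : c 0 = 1) : AlgDist B where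
  mom n := c n • μ.mom n
  mom_one := by simp [hc, μ.mom_one]
  mom_left n b x := by
    rw [smul_apply, smul_apply, μ.mom_left, mul_smul_comm]
  mom_right n b y := by
    rw [smul_apply, smul_apply, μ.mom_right, smul_mul_assoc]

theorem AlgDist.wordMoment_scaleMoments (μ : AlgDist B) (c : ℕ → ℂ) (hc : c 0 = 1) {m : ℕ}
    (hm : 1 ≤ m) (w : Fin m → B) :
    (μ.scaleMoments c hc).wordMoment m w = c (m - 1) • μ.wordMoment m w := by
  obtain ⟨m, rfl⟩ := Nat.exists_eq_add_of_le' hm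
  rfl

/-- `μ[X b₁ X b₂ ⋯ X bₙ]` as a multilinear map of `b₁, …, bₙ`, multiplied by the scalar `r n`. -/
noncomputable def AlgDist.scaledCumulant (μ : AlgDist B) (r : ℕ → ℂ) (n : ℕ) :
    MultilinearMap ℂ (fun _ : Fin n => B) B :=
  r n • (μ.mom n).curryLeft 1

theorem AlgDist.scaledCumulant_apply (μ : AlgDist B) (r : ℕ → ℂ) (n : ℕ) (b : Fin n → B) :
    μ.scaledCumulant r n b = r n • μ.mom n (Fin.cons 1 b) := rfl

/-- If moments of moments over the blocks of a composition collapse to a single moment of `μ`, then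
the moment–cumulant formula for the rescaled moments of `μ` reduces to scalars. -/
theorem isFreeCumulant_scaleMoments (μ : AlgDist B) (c r : ℕ → ℂ) (hc : c 0 = 1) (hr : r 0 = 0)
    (hcr : ∀ n, 0 < n → c n = ∑ p : Composition n, r p.length * ∏ i, c (p.blocksFun i - 1))
    (hμ : ∀ (n : ℕ) (p : Composition n) (b : Fin n → B), (∀ i, c (p.blocksFun i - 1) ≠ 0) →
      μ.mom p.length (Fin.cons 1 fun i => μ.wordMoment (p.blocksFun i) fun j => b (p.embedding i j))
        = μ.mom n (Fin.cons 1 b)) :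
    IsFreeCumulant (μ.scaleMoments c hc) (μ.scaledCumulant r) := by
  refine ⟨by rw [AlgDist.scaledCumulant, hr, zero_smul], fun n hn b => ?_⟩
  change c n • μ.mom n _ = _
  rw [hcr n hn, Finset.sum_smul]
  refine Finset.sum_congr rfl fun p _ => ?_
  simp only [μ.wordMoment_scaleMoments c hc (p.one_le_blocksFun _)]
  rw [MultilinearMap.map_smul_univ, AlgDist.scaledCumulant_apply, smul_smul, mul_comm]
  -- If some factor $c$ vanishes, both terms are zero and no collapse is needed.
  by_cases h : ∀ i, c (p.blocksFun i - 1) ≠ 0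
  · rw [hμ n p b h]
  · push Not at h
    obtain ⟨i, hi⟩ := h
    rw [Finset.prod_eq_zero (Finset.mem_univ i) hi, zero_mul, zero_smul, zero_smul]

end

/-! ### Words in $a$ and $B$. -/

theorem prod_ofFn_composition {M : Type*} [Monoid M] {n : ℕ} (p : Composition n) (f : Fin n → M) :
    (List.ofFn fun i => (List.ofFn fun j => f (p.embedding i j)).prod).prod =
      (List.ofFn f).prod := by
  have hlen : (List.ofFn f).length = n := List.length_ofFn
  have h : List.ofFn (fun i => List.ofFn fun j => f (p.embedding i j)) =
      (List.ofFn f).splitWrtComposition p := by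
    apply List.ext_getElem
    · rw [List.length_ofFn, List.length_splitWrtComposition]
    · intro i h1 h2
      have hi : i < p.length := by simpa using h1
      rw [List.getElem_splitWrtComposition, List.getElem_ofFn]
      have hle : p.sizeUpTo (i + 1) ≤ n := p.sizeUpTo_le _
      have hs := p.sizeUpTo_succ' ⟨i, hi⟩
      simp only at hs
      apply List.ext_getElem
      · rw [hs] at hle
        simp [hs, min_eq_left hle]
      · intro j _ _
        simp [Composition.embedding]
  have hfl : ∀ (l : List M) (h : l.length = n), (l.splitWrtComposition p).flatten = l := by
    rintro l rfl
    exact List.flatten_splitWrtComposition l p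
  rw [← hfl _ hlen, ← h, List.prod_flatten, List.map_ofFn]
  rfl

section Monomial

variable {A B : Type*} [CStarAlgebra A] [CStarAlgebra B]

theorem ncMonomial_cons (ι : B →⋆ₐ[ℂ] A) (a : A) (n : ℕ) (b : Fin (n + 2) → B) :
    ncMonomial ι a (n + 1) b = ι (b 0) * a * ncMonomial ι a n (Fin.tail b) := by
  rw [ncMonomial_apply, ncMonomial_apply, List.ofFn_succ]
  simp [mul_assoc, Fin.tail]

theorem mul_ncMonomial (ι : B →⋆ₐ[ℂ] A) (a : A) (n : ℕ) (b : Fin (n + 1) → B) :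
    a * ncMonomial ι a n b = (List.ofFn fun i => a * ι (b i)).prod := by
  rw [ncMonomial_apply, List.ofFn_succ, List.prod_cons, mul_assoc]

theorem ncMonomial_zero_apply (ι : B →⋆ₐ[ℂ] A) (a : A) (b : Fin 1 → B) :
    ncMonomial ι a 0 b = ι (b 0) := by
  simp [ncMonomial_apply]

theorem ncMonomial_shift_cons (ι : B →⋆ₐ[ℂ] A) (a : A) (b : ℕ → B) (i n : ℕ) :
    ncMonomial ι a (n + 1) (fun r => b (i + r)) =
      ι (b i) * a * ncMonomial ι a n (fun r => b (i + 1 + r)) := by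
  rw [ncMonomial_cons, show Fin.tail (fun r : Fin (n + 2) => b (i + r)) =
    fun r : Fin (n + 1) => b (i + 1 + r) from
      funext fun r => congrArg b (by rw [Fin.val_succ, add_assoc, add_comm 1 (r : ℕ)])]
  rfl

theorem ncMonomial_split (ι : B →⋆ₐ[ℂ] A) (a : A) (b : ℕ → B) (i m k : ℕ) :
    ncMonomial ι a (m + 1 + k) (fun r => b (i + r)) =
      ncMonomial ι a m (fun r => b (i + r)) * a *
        ncMonomial ι a k (fun r => b (i + m + 1 + r)) := by
  induction m generalizing i with
  | zero =>
    rw [show 0 + 1 + k = k + 1 by omega, ncMonomial_shift_cons, ncMonomial_zero_apply]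
    simp
  | succ m ih =>
    rw [show m + 1 + 1 + k = (m + 1 + k) + 1 by omega, ncMonomial_shift_cons, ih,
      ncMonomial_shift_cons]
    simp only [mul_assoc, show i + 1 + m + 1 = i + (m + 1) + 1 by omega]

/-- The gluing step behind both (a) and (b): as $\alpha(x)=axa$, the word inside the pair $\{i,k\}$
and the word to its right reassemble into the whole segment. -/
theorem ncMonomial_pair (ι : B →⋆ₐ[ℂ] A) (a : A) {α : B → B}
    (hα : ∀ b : B, ι (α b) = a * ι b * a) (b : ℕ → B) {i k j : ℕ} (hik : i < k) (hkj : k < j)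
    {x y : B} (hx : ι x = ncMonomial ι a (k - (i + 1)) (fun r => b (i + 1 + r)))
    (hy : ι y = ncMonomial ι a (j - (k + 1)) (fun r => b (k + 1 + r))) :
    ι (b i * α x * y) = ncMonomial ι a (j - i) (fun r => b (i + r)) := by
  rw [map_mul, map_mul, hα, hx, hy,
    show j - i = (k - (i + 1) + 1 + (j - (k + 1))) + 1 by omega, ncMonomial_shift_cons,
    ncMonomial_split, show i + 1 + (k - (i + 1)) + 1 = k + 1 by omega]
  simp only [mul_assoc]

/-- Two letters are peeled off on the right: the factor $aba$ between shorter words lies in $B$. -/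
theorem ncMonomial_even_mem_range (ι : B →⋆ₐ[ℂ] A) (a : A)
    (haB : ∀ b : B, a * ι b * a ∈ Set.range ι) (n : ℕ) (b : Fin (2 * n + 1) → B) :
    ncMonomial ι a (2 * n) b ∈ Set.range ι := by
  induction n with
  | zero => exact ⟨b 0, (ncMonomial_zero_apply ι a b).symm⟩
  | succ n ih =>
    change ncMonomial ι a (2 * n + 1 + 1) b ∈ _
    rw [ncMonomial_snoc, ncMonomial_snoc]
    obtain ⟨x, hx⟩ := ih fun i => b i.castSucc.castSucc
    obtain ⟨y, hy⟩ := haB (b (Fin.last (2 * n + 1)).castSucc)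
    refine ⟨x * y * b (Fin.last (2 * n + 1 + 1)), ?_⟩
    rw [map_mul, map_mul, hx, hy]
    simp only [mul_assoc]

theorem ncMonomial_range_nat (ι : B →⋆ₐ[ℂ] A) (a : A) (n : ℕ) (b : Fin (n + 1) → B) :
    ncMonomial ι a n (fun r => (fun i => b (Fin.ofNat (n + 1) i)) (0 + r)) = ncMonomial ι a n b := by
  congr 1
  funext r
  simp

end Monomial

/-! ### The distribution of $a$ and its free convolution powers. -/

section Distribution

variable {A B : Type*} [CStarAlgebra A] [PartialOrder A] [CStarAlgebra B] [PartialOrder B]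

theorem IsCondExpectation.injective {ι : B →⋆ₐ[ℂ] A} {E : A →ₗ[ℂ] B}
    (hE : IsCondExpectation ι E) : Function.Injective ι :=
  Function.LeftInverse.injective hE.E_ι

theorem ι_distribution_even (ι : B →⋆ₐ[ℂ] A) (E : A →ₗ[ℂ] B) (hE : IsCondExpectation ι E)
    (a : A) (haB : ∀ b : B, a * ι b * a ∈ Set.range ι) (n : ℕ) (b : Fin (2 * n + 1) → B) :
    ι ((distribution ι E hE a).mom (2 * n) b) = ncMonomial ι a (2 * n) b := by
  obtain ⟨x, hx⟩ := ncMonomial_even_mem_range ι a haB n b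
  change ι (E (ncMonomial ι a (2 * n) b)) = _
  rw [← hx, hE.E_ι]

theorem distribution_odd (ι : B →⋆ₐ[ℂ] A) (E : A →ₗ[ℂ] B) (hE : IsCondExpectation ι E)
    (a : A) (ha0 : E a = 0) (haB : ∀ b : B, a * ι b * a ∈ Set.range ι) (n : ℕ) (hn : Odd n)
    (b : Fin (n + 1) → B) : (distribution ι E hE a).mom n b = 0 := by
  obtain ⟨n, rfl⟩ := hn
  obtain ⟨x, hx⟩ := ncMonomial_even_mem_range ι a haB n fun i => b i.castSucc
  change E (ncMonomial ι a (2 * n + 1) b) = _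
  rw [ncMonomial_snoc, ← hx, ← mul_assoc, hE.bimodule, ha0, mul_zero, zero_mul]

/-- Each block has an even number of letters, so its moment is the actual word in $A$; with the
letter $a$ in front, the blocks concatenate to the full word by `prod_ofFn_composition`. -/
theorem distribution_composition (ι : B →⋆ₐ[ℂ] A) (E : A →ₗ[ℂ] B) (hE : IsCondExpectation ι E)
    (a : A) (haB : ∀ b : B, a * ι b * a ∈ Set.range ι) (n : ℕ) (p : Composition n)
    (b : Fin n → B) (hp : ∀ i, Even (p.blocksFun i - 1)) :
    (distribution ι E hE a).mom p.length (Fin.cons 1 fun i =>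
        (distribution ι E hE a).wordMoment (p.blocksFun i) fun j => b (p.embedding i j)) =
      (distribution ι E hE a).mom n (Fin.cons 1 b) := by
  have key : ∀ (m : ℕ), 1 ≤ m → Even (m - 1) → ∀ w : Fin m → B,
      a * ι ((distribution ι E hE a).wordMoment m w) = (List.ofFn fun j => a * ι (w j)).prod := by
    intro m hm he w
    obtain ⟨m, rfl⟩ := Nat.exists_eq_add_of_le' hm
    obtain ⟨k, rfl⟩ := even_iff_exists_two_mul.1 he
    rw [← mul_ncMonomial, ← ι_distribution_even ι E hE a haB]
    rfl
  change E (ncMonomial ι a _ _) = E (ncMonomial ι a _ _)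
  congr 1
  rw [ncMonomial_apply, ncMonomial_apply]
  simp only [Fin.cons_zero, Fin.cons_succ]
  rw [← prod_ofFn_composition p]
  congr 3
  funext i
  exact key _ (p.one_le_blocksFun i) (hp i) _

/-- The complex scalars `c_n` with `c_{2n} = m_n(t)` and `c_n = 0` for odd `n`. -/
noncomputable def symmetricMoment (t : ℝ) (n : ℕ) : ℂ :=
  (PowerSeries.coeff n (symmetricMomentSeries t) : ℝ)

theorem symmetricMoment_even (t : ℝ) (n : ℕ) :
    symmetricMoment t (2 * n) = (freeBinomialMoment n t : ℝ) := by
  rw [symmetricMoment, coeff_symmetricMomentSeries_even]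

theorem symmetricMoment_odd (t : ℝ) (n : ℕ) (hn : Odd n) : symmetricMoment t n = 0 := by
  rw [symmetricMoment, coeff_symmetricMomentSeries_odd t n hn, Complex.ofReal_zero]

theorem symmetricMoment_zero (t : ℝ) : symmetricMoment t 0 = 1 := by
  have h := symmetricMoment_even t 0
  rwa [mul_zero, freeBinomialMoment_zero, Complex.ofReal_one] at h

theorem isFreeCumulant_distribution (ι : B →⋆ₐ[ℂ] A) (E : A →ₗ[ℂ] B)
    (hE : IsCondExpectation ι E) (a : A) (haB : ∀ b : B, a * ι b * a ∈ Set.range ι)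
    (t : ℝ) (ht : t ≠ 0) :
    IsFreeCumulant
      ((distribution ι E hE a).scaleMoments (symmetricMoment t) (symmetricMoment_zero t))
      ((distribution ι E hE a).scaledCumulant
        fun n => ((t * PowerSeries.coeff n bernoulliCumulant : ℝ) : ℂ)) := by
  apply isFreeCumulant_scaleMoments
  · have h := constantCoeff_bernoulliCumulant
    rw [← PowerSeries.coeff_zero_eq_constantCoeff_apply] at h
    simp [h]
  · intro n hn
    simp only [symmetricMoment]
    rw [coeff_symmetricMomentSeries_eq_sum t ht n hn]
    push_cast
    rfl
  · intro n p b hp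
    refine distribution_composition ι E hE a haB n p b fun i => ?_
    by_contra h
    rw [Nat.not_even_iff_odd] at h
    exact hp i (symmetricMoment_odd t _ h)

theorem scaleMoments_one_distribution (ι : B →⋆ₐ[ℂ] A) (E : A →ₗ[ℂ] B)
    (hE : IsCondExpectation ι E) (a : A) (ha0 : E a = 0)
    (haB : ∀ b : B, a * ι b * a ∈ Set.range ι) :
    (distribution ι E hE a).scaleMoments (symmetricMoment 1) (symmetricMoment_zero 1) =
      distribution ι E hE a := by
  ext n b
  change symmetricMoment 1 n • (distribution ι E hE a).mom n b = _
  rcases Nat.even_or_odd n with h | h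
  · obtain ⟨n, rfl⟩ := even_iff_exists_two_mul.1 h
    rw [symmetricMoment_even, freeBinomialMoment_one, Complex.ofReal_one, one_smul]
  · rw [distribution_odd ι E hE a ha0 haB n h, smul_zero]

theorem isFreeConvPower_distribution (ι : B →⋆ₐ[ℂ] A) (E : A →ₗ[ℂ] B)
    (hE : IsCondExpectation ι E) (a : A) (ha0 : E a = 0)
    (haB : ∀ b : B, a * ι b * a ∈ Set.range ι) (t : ℝ) (ht : t ≠ 0) :
    IsFreeConvPower (distribution ι E hE a) t
      ((distribution ι E hE a).scaleMoments (symmetricMoment t) (symmetricMoment_zero t)) := by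
  -- Since $m_n(1)=1$, the case $t=1$ gives the cumulants of $\mu_a$ itself; those for general $t$
  -- are $t$ times these.
  have h1 := isFreeCumulant_distribution ι E hE a haB 1 one_ne_zero
  rw [scaleMoments_one_distribution ι E hE a ha0 haB] at h1
  refine ⟨_, h1, ?_⟩
  convert isFreeCumulant_distribution ι E hE a haB t ht using 2 with n
  rw [AlgDist.scaledCumulant, AlgDist.scaledCumulant, smul_smul]
  push_cast
  rw [one_mul]

end Distribution

/-! ### Complete positivity of $\alpha$. -/

section CompletelyPositive

/-- A $*$-homomorphism commutes with the functional calculus, so it sends the negative part of $x$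
to that of $\varphi(x)$, which is zero; injectivity concludes. -/
theorem nonneg_of_map_nonneg {C D : Type*} [NonUnitalCStarAlgebra C] [PartialOrder C]
    [StarOrderedRing C] [NonUnitalCStarAlgebra D] [PartialOrder D] [StarOrderedRing D]
    (φ : C →⋆ₙₐ[ℂ] D) (hφ : Function.Injective φ) (x : C) (hx : 0 ≤ φ x) : 0 ≤ x := by
  have hsa : IsSelfAdjoint x := by
    apply hφ
    rw [map_star]
    exact (IsSelfAdjoint.of_nonneg hx).star_eq
  have hneg : φ (x⁻) = (φ x)⁻ := by
    rw [CFC.negPart_def, CFC.negPart_def]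
    exact NonUnitalStarAlgHomClass.map_cfcₙ (S := ℂ) φ _ x
  rw [← CFC.negPart_eq_zero_iff x hsa]
  apply hφ
  rw [hneg, map_zero, CFC.negPart_eq_zero_iff _ (IsSelfAdjoint.of_nonneg hx)]
  exact hx

theorem exists_completelyPositive {A B : Type*} [CStarAlgebra A] [PartialOrder A]
    [StarOrderedRing A] [CStarAlgebra B] [PartialOrder B] [StarOrderedRing B]
    (ι : B →⋆ₐ[ℂ] A) (hι : Function.Injective ι) (a : A) (ha : IsSelfAdjoint a)
    (α : B → B) (hα : ∀ b : B, ι (α b) = a * ι b * a) : ∃ φ : B →CP B, ∀ b, φ b = α b := by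
  let L : B →ₗ[ℂ] B :=
    { toFun := α
      map_add' := fun x y => hι (by simp only [hα, map_add, mul_add, add_mul])
      map_smul' := fun c x => hι (by simp [hα]) }
  refine ⟨⟨L, fun k M hM => ?_⟩, fun _ => rfl⟩
  let ι' : B →⋆ₙₐ[ℂ] A := ι
  refine nonneg_of_map_nonneg (CStarMatrix.mapₙₐ ι') ?_ _ ?_
  · exact CStarMatrix.map_injective hι
  -- Entrywise, $\iota(\alpha(M))=d^*\iota(M)d$ with $d=\mathrm{diag}(a,\dots,a)$, a conjugate of a
  -- positive matrix.
  · let d : CStarMatrix (Fin k) (Fin k) A := CStarMatrix.ofMatrix (Matrix.diagonal fun _ => a)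
    have hd : star d = d := by
      ext i j
      rw [CStarMatrix.star_apply]
      simp only [d, CStarMatrix.ofMatrix_apply, Matrix.diagonal_apply]
      by_cases h : i = j
      · simp [h, ha.star_eq]
      · simp [h, Ne.symm h]
    have h1 : 0 ≤ CStarMatrix.mapₙₐ ι' M := map_nonneg _ hM
    have h2 := star_left_conjugate_nonneg h1 d
    convert h2 using 1
    rw [hd]
    ext i j
    simp only [CStarMatrix.mul_apply, d, CStarMatrix.ofMatrix_apply, Matrix.diagonal_apply,
      CStarMatrix.mapₙₐ_apply, CStarMatrix.mapₗ_apply, CStarMatrix.map_apply]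
    simp [ι', L, hα]

end CompletelyPositive

/-! ### Non-crossing pair partitions with constant Jacobi parameters. -/

section Partitions

variable {n : ℕ}

theorem mem_ncPair {π : Finpartition (Finset.range n)} :
    π ∈ ncPair n ↔ IsNoncrossing π ∧ ∀ U ∈ π.parts, U.card = 2 := by
  simp [ncPair]

theorem mem_ncOneTwo {π : Finpartition (Finset.range n)} :
    π ∈ ncOneTwo n ↔ IsNoncrossing π ∧ ∀ U ∈ π.parts, U.card = 1 ∨ U.card = 2 := by
  simp [ncOneTwo]

theorem part_sup_mem (π : Finpartition (Finset.range n)) {i : ℕ} (hi : i < n) :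
    (π.part i).sup id ∈ π.part i := by
  obtain ⟨x, hx, h⟩ := Finset.exists_mem_eq_sup (π.part i)
    ⟨i, π.mem_part_self.2 (Finset.mem_range.2 hi)⟩ id
  rw [h]
  exact hx

theorem mem_part_lt {π : Finpartition (Finset.range n)} {i x : ℕ} (hx : x ∈ π.part i) : x < n :=
  Finset.mem_range.1 (π.part_subset i hx)

/-- If a block of cardinality at most two has maximum `k` at the element `i ≠ k`, it is
`{i, k}`. -/
theorem part_eq_pair {π : Finpartition (Finset.range n)} {i k : ℕ} (hi : i < n)
    (hcard : (π.part i).card ≤ 2) (hk : (π.part i).sup id = k) (hik : i ≠ k) :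
    π.part i = {i, k} := by
  symm
  apply Finset.eq_of_subset_of_card_le
  · intro x hx
    rcases Finset.mem_insert.1 hx with rfl | hx
    · exact π.mem_part_self.2 (Finset.mem_range.2 hi)
    · rw [Finset.mem_singleton.1 hx, ← hk]
      exact part_sup_mem π hi
  · rwa [Finset.card_pair hik]

theorem IsNoncrossing.part_eq {π : Finpartition (Finset.range n)} (h : IsNoncrossing π)
    {i j k l : ℕ} (hk : k ∈ π.part i) (hl : l ∈ π.part j) (hij : i < j) (hjk : j < k)
    (hkl : k < l) : π.part i = π.part j := by
  have hi : i ∈ Finset.range n := Finset.mem_range.2 (by have := mem_part_lt hk; omega)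
  have hj : j ∈ Finset.range n := Finset.mem_range.2 (by have := mem_part_lt hk; omega)
  exact h _ (π.part_mem.2 hi) _ (π.part_mem.2 hj) i j k l (π.mem_part_self.2 hi)
    (π.mem_part_self.2 hj) hk hl hij hjk hkl

theorem IsNoncrossing.part_eq' {π : Finpartition (Finset.range n)} (h : IsNoncrossing π)
    {i j k l : ℕ} (hk : k ∈ π.part i) (hl : l ∈ π.part j) (hil : i < l) (hlk : l < k)
    (hkj : k < j) : π.part i = π.part j := by
  have hj : j ∈ Finset.range n := by
    by_contra hj
    rw [π.part_eq_empty.2 hj] at hl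
    simp at hl
  have hlr : l ∈ Finset.range n := π.part_subset j hl
  have e : π.part l = π.part j := (π.mem_part_iff_part_eq_part hlr hj).1 hl
  rw [← e]
  exact h.part_eq hk (by rw [e]; exact π.mem_part_self.2 hj) hil hlk hkj

end Partitions

section PairPartitions

variable {A B : Type*} [CStarAlgebra A] [CStarAlgebra B]

/-- Induction on the length of a segment that is a union of blocks (`hclosed`). The first letter is
paired with some $k$, and non-crossing makes the parts inside and to the right of the pair unions of
blocks again. The depth may vary freely because all the maps equal $\alpha$. -/
theorem ι_jacobiSegment_ncPair (ι : B →⋆ₐ[ℂ] A) (a : A) (α : B → B)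
    (hα : ∀ b : B, ι (α b) = a * ι b * a) {n : ℕ} (π : Finpartition (Finset.range n))
    (hπ : π ∈ ncPair n) (b : ℕ → B) (m d i j : ℕ) (hm : j - i = m) (hij : i ≤ j) (hjn : j ≤ n)
    (hclosed : ∀ x, i ≤ x → x < j → ∀ z ∈ π.part x, i ≤ z ∧ z < j) :
    ι (jacobiSegment (fun _ => 0) (fun _ => α) π b d i j) =
      ncMonomial ι a (j - i) (fun r => b (i + r)) := by
  obtain ⟨hnc, hcard⟩ := mem_ncPair.1 hπ
  induction m using Nat.strong_induction_on generalizing d i j with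
  | _ m ih =>
  rw [jacobiSegment]
  by_cases hlt : i < j
  swap
  · obtain rfl : i = j := by omega
    rw [if_neg hlt, Nat.sub_self, ncMonomial_zero_apply]
    rfl
  rw [if_pos hlt]
  have hin : i < n := by omega
  have hc : (π.part i).card = 2 := hcard _ (π.part_mem.2 (Finset.mem_range.2 hin))
  have hself : i ∈ π.part i := π.mem_part_self.2 (Finset.mem_range.2 hin)
  obtain ⟨k, hk⟩ : ∃ k, (π.part i).sup id = k := ⟨_, rfl⟩
  have hkm : k ∈ π.part i := hk ▸ part_sup_mem π hin
  have hkc := hclosed i le_rfl hlt k hkm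
  have hik : i ≠ k := by
    rintro rfl
    have hsub : π.part i ⊆ {i} := by
      intro z hz
      have h1 := (hclosed i le_rfl hlt z hz).1
      have h2 : z ≤ i := hk ▸ Finset.le_sup (f := id) hz
      exact Finset.mem_singleton.2 (by omega)
    have := Finset.card_le_card hsub
    rw [hc, Finset.card_singleton] at this
    omega
  have hpair := part_eq_pair hin hc.le hk hik
  have hne : ∀ x, x < n → x ≠ i → x ≠ k → ∀ z ∈ π.part x, z ≠ i ∧ z ≠ k := by
    intro x hx hxi hxk z hz
    have hx' := Finset.mem_range.2 hx
    have hzx := (π.mem_part_iff_part_eq_part (π.part_subset x hz) hx').1 hz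
    have hnot : π.part x ≠ π.part i := by
      intro h
      have := (π.mem_part_iff_part_eq_part hx' (Finset.mem_range.2 hin)).2 h
      rw [hpair] at this
      simp [hxi, hxk] at this
    constructor
    · rintro rfl
      exact hnot hzx.symm
    · rintro rfl
      exact hnot (hzx.symm.trans ((π.mem_part_iff_part_eq_part (Finset.mem_range.2 (by omega))
        (Finset.mem_range.2 hin)).1 hkm))
  have hnot : ∀ x, x < n → x ≠ i → x ≠ k → π.part i ≠ π.part x := by
    intro x hx hxi hxk h
    exact (hne x hx hxi hxk i (h ▸ hself)).1 rfl
  rw [hk, if_neg (by omega), if_pos (by omega)]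
  have hlt' : i < k := by omega
  refine ncMonomial_pair ι a hα b hlt' hkc.2 ?_ ?_
  · refine ih _ ?_ (d + 1) (i + 1) k rfl (by omega) (by omega) ?_
    · omega
    intro x hx1 hx2 z hz
    have h1 := hclosed x (by omega) (by omega) z hz
    have h2 := hne x (by omega) (by omega) (by omega) z hz
    -- A block leaving the inside of $\{i,k\}$ would cross it.
    have h3 : ¬ k < z := fun h =>
      hnot x (by omega) (by omega) (by omega) (hnc.part_eq hkm hz (by omega) hx2 h)
    omega
  · refine ih _ ?_ d (k + 1) j rfl (by omega) (by omega) ?_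
    · omega
    intro x hx1 hx2 z hz
    have h1 := hclosed x (by omega) (by omega) z hz
    have h2 := hne x (by omega) (by omega) (by omega) z hz
    have h3 : ¬ z < k := fun h =>
      hnot x (by omega) (by omega) (by omega) (hnc.part_eq' hkm hz (by omega) h (by omega))
    omega

theorem ι_jacobiTerm_ncPair (ι : B →⋆ₐ[ℂ] A) (a : A) (α : B → B)
    (hα : ∀ b : B, ι (α b) = a * ι b * a) {n : ℕ} (π : Finpartition (Finset.range n))
    (hπ : π ∈ ncPair n) (b : Fin (n + 1) → B) :
    ι (jacobiTerm (fun _ => 0) (fun _ => α) π b) = ncMonomial ι a n b := by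
  rw [jacobiTerm, ι_jacobiSegment_ncPair ι a α hα π hπ _ n 0 0 n rfl n.zero_le le_rfl
    fun x _ _ z hz => ⟨z.zero_le, mem_part_lt hz⟩]
  exact ncMonomial_range_nat ι a n b

end PairPartitions

/-! ### The Bernoulli distribution: only adjacent pairs contribute. -/

section Bernoulli

variable {n : ℕ}

/-- In the letters `i, i + 1, …`, the `m` pairs `{i, i + 1}, {i + 2, i + 3}, …` are matched. -/
def IsIntervalPaired (π : Finpartition (Finset.range n)) (i m : ℕ) : Prop :=
  ∀ r < m, (π.part (i + 2 * r)).sup id = i + 2 * r + 1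

theorem isIntervalPaired_succ {π : Finpartition (Finset.range n)} {i m : ℕ} :
    IsIntervalPaired π i (m + 1) ↔
      (π.part i).sup id = i + 1 ∧ IsIntervalPaired π (i + 2) m := by
  constructor
  · intro h
    refine ⟨h 0 m.succ_pos, fun r hr => ?_⟩
    have := h (r + 1) (by omega)
    rwa [show i + 2 * (r + 1) = i + 2 + 2 * r by ring] at this
  · rintro ⟨h0, h⟩ r hr
    cases r with
    | zero => exact h0
    | succ r =>
      have := h r (by omega)
      rwa [show i + 2 + 2 * r = i + 2 * (r + 1) by ring] at this

/-- The Jacobi maps `(α, 0, 0, …)` of a Bernoulli distribution. -/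
def bernoulliMaps {B : Type*} [Zero B] (α : B → B) (d : ℕ) : B → B :=
  if d = 0 then α else fun _ => 0

section Ring

variable {B : Type*} [Ring B] (α : B → B) (π : Finpartition (Finset.range n)) (b : ℕ → B)

/-- Below the outer level all the parameters vanish, so any letter there kills the term. -/
theorem jacobiSegment_bernoulli_inner {d i j : ℕ} (hij : i < j) :
    jacobiSegment (fun _ => 0) (bernoulliMaps α) π b (d + 1) i j = 0 := by
  rw [jacobiSegment, if_pos hij]
  split_ifs <;> simp [bernoulliMaps]

theorem isIntervalPaired_of_jacobiSegment_ne_zero (hα0 : α 0 = 0) (l i j : ℕ) (hl : j - i = l)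
    (hij : i ≤ j) (h : jacobiSegment (fun _ => 0) (bernoulliMaps α) π b 0 i j ≠ 0) :
    ∃ m, j = i + 2 * m ∧ IsIntervalPaired π i m := by
  induction l using Nat.strong_induction_on generalizing i with
  | _ l ih =>
  rcases hij.eq_or_lt with rfl | hlt
  · exact ⟨0, rfl, fun r hr => absurd hr r.not_lt_zero⟩
  rw [jacobiSegment, if_pos hlt] at h
  split_ifs at h with h1 h2
  · simp at h
  · by_cases h3 : (π.part i).sup id = i + 1
    · rw [h3] at h h2
      obtain ⟨m, hm, hp⟩ := ih (j - (i + 2)) (by omega) (i + 2) rfl (by omega)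
        (right_ne_zero_of_mul h)
      exact ⟨m + 1, by omega, isIntervalPaired_succ.2 ⟨h3, hp⟩⟩
    -- A pair $\{i,k\}$ with $k>i+1$ encloses a letter, so it contributes $\alpha(0)=0$.
    · rw [jacobiSegment_bernoulli_inner α π b (by omega)] at h
      simp [bernoulliMaps, hα0] at h
  · exact absurd rfl h

end Ring

theorem ι_jacobiSegment_bernoulli {A B : Type*} [CStarAlgebra A] [CStarAlgebra B]
    (ι : B →⋆ₐ[ℂ] A) (a : A) (α : B → B) (hα : ∀ b : B, ι (α b) = a * ι b * a)
    (π : Finpartition (Finset.range n)) (b : ℕ → B) (m i : ℕ) (h : IsIntervalPaired π i m) :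
    ι (jacobiSegment (fun _ => 0) (bernoulliMaps α) π b 0 i (i + 2 * m)) =
      ncMonomial ι a (2 * m) (fun r => b (i + r)) := by
  induction m generalizing i with
  | zero =>
    rw [jacobiSegment, if_neg (by omega)]
    exact (ncMonomial_zero_apply ι a fun r : Fin 1 => b (i + r)).symm
  | succ m ih =>
    obtain ⟨h0, h⟩ := isIntervalPaired_succ.1 h
    rw [jacobiSegment, if_pos (by omega), h0, if_neg (by omega), if_pos (by omega)]
    have hpair := ncMonomial_pair ι a hα b (i := i) (k := i + 1) (j := i + 2 * (m + 1))
      (x := b (i + 1))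
      (y := jacobiSegment (fun _ => 0) (bernoulliMaps α) π b 0 (i + 2) (i + 2 + 2 * m))
      (by omega) (by omega) ?_ ?_
    · rw [Nat.add_sub_cancel_left] at hpair
      rw [← hpair, jacobiSegment, if_neg (by omega)]
      simp only [bernoulliMaps, if_true]
      rw [show i + 2 * (m + 1) = i + 2 + 2 * m by ring]
    · rw [Nat.sub_self, ncMonomial_zero_apply]
      rfl
    · rw [ih (i + 2) h, show i + 2 * (m + 1) - (i + 1 + 1) = 2 * m by omega]

open Classical in
/-- The partition of `{0, …, n - 1}` into the blocks `{2r, 2r + 1}`. -/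
noncomputable def intervalPairing (n : ℕ) : Finpartition (Finset.range n) :=
  Finpartition.ofSetSetoid (Setoid.ker fun x : ℕ => x / 2) (Finset.range n)

theorem mem_part_intervalPairing {x z : ℕ} :
    z ∈ (intervalPairing n).part x ↔ x < n ∧ z < n ∧ x / 2 = z / 2 := by
  rw [intervalPairing, Finpartition.mem_part_ofSetSetoid_iff_rel]
  simp

theorem part_intervalPairing {m r : ℕ} (hr : r < m) :
    (intervalPairing (2 * m)).part (2 * r) = {2 * r, 2 * r + 1} := by
  ext z
  rw [mem_part_intervalPairing, Finset.mem_insert, Finset.mem_singleton]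
  omega

theorem isIntervalPaired_intervalPairing (m : ℕ) :
    IsIntervalPaired (intervalPairing (2 * m)) 0 m := by
  intro r hr
  rw [zero_add, part_intervalPairing hr]
  simp

theorem intervalPairing_mem_ncOneTwo (m : ℕ) : intervalPairing (2 * m) ∈ ncOneTwo (2 * m) := by
  refine mem_ncOneTwo.2 ⟨?_, ?_⟩
  · intro U hU V hV i j k l hi hj hk hl hij hjk hkl
    rw [← Finpartition.part_eq_of_mem _ hU hi] at hk ⊢
    rw [← Finpartition.part_eq_of_mem _ hV hj] at hl ⊢
    rw [mem_part_intervalPairing] at hk hl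
    omega
  · intro U hU
    obtain ⟨x, hx⟩ := Finpartition.nonempty_of_mem_parts _ hU
    have hU' := Finpartition.part_eq_of_mem _ hU hx
    have hxn : x < 2 * m := Finset.mem_range.1 (Finpartition.subset _ hU hx)
    have hmem : 2 * (x / 2) ∈ U := by
      rw [← hU', mem_part_intervalPairing]
      omega
    rw [← Finpartition.part_eq_of_mem _ hU hmem, part_intervalPairing (by omega),
      Finset.card_pair (by omega)]
    exact Or.inr rfl

theorem finpartition_ext_part {s : Finset ℕ} {π σ : Finpartition s}
    (h : ∀ x ∈ s, π.part x = σ.part x) : π = σ := by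
  have key : ∀ {π σ : Finpartition s}, (∀ x ∈ s, π.part x = σ.part x) → π.parts ⊆ σ.parts := by
    intro π σ h t ht
    obtain ⟨x, hx⟩ := π.nonempty_of_mem_parts ht
    have hxs := π.subset ht hx
    rw [← π.part_eq_of_mem ht hx, h x hxs]
    exact σ.part_mem.2 hxs
  exact Finpartition.ext ((key h).antisymm (key fun x hx => (h x hx).symm))

/-- `IsIntervalPaired` records only the maxima of the blocks of even letters; these determine $\pi$
because blocks have at most two elements. -/
theorem eq_intervalPairing {m : ℕ} {π : Finpartition (Finset.range (2 * m))}
    (hπ : π ∈ ncOneTwo (2 * m)) (h : IsIntervalPaired π 0 m) : π = intervalPairing (2 * m) := by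
  have hcard := (mem_ncOneTwo.1 hπ).2
  have heven : ∀ r < m, π.part (2 * r) = {2 * r, 2 * r + 1} := by
    intro r hr
    have h0 := h r hr
    rw [zero_add] at h0
    refine part_eq_pair (by omega) ?_ h0 (by omega)
    rcases hcard _ (π.part_mem.2 (Finset.mem_range.2 (by omega : 2 * r < 2 * m))) with h | h <;>
      omega
  apply finpartition_ext_part
  intro x hx
  have hx' := Finset.mem_range.1 hx
  have hr : x / 2 < m := by omega
  have hxmem : x ∈ ({2 * (x / 2), 2 * (x / 2) + 1} : Finset ℕ) := by
    rw [Finset.mem_insert, Finset.mem_singleton]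
    omega
  have key : ∀ σ : Finpartition (Finset.range (2 * m)),
      σ.part (2 * (x / 2)) = {2 * (x / 2), 2 * (x / 2) + 1} →
        σ.part x = {2 * (x / 2), 2 * (x / 2) + 1} := by
    intro σ hσ
    refine (σ.part_eq_iff_mem ?_).2 hxmem
    rw [← hσ]
    exact σ.part_mem.2 (Finset.mem_range.2 (by omega))
  rw [key π (heven _ hr), key _ (part_intervalPairing hr)]

theorem isCenteredBernoulli_distribution {A B : Type*} [CStarAlgebra A] [PartialOrder A]
    [CStarAlgebra B] [PartialOrder B]
    (ι : B →⋆ₐ[ℂ] A) (E : A →ₗ[ℂ] B) (hE : IsCondExpectation ι E)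
    (a : A) (ha0 : E a = 0) (haB : ∀ b : B, a * ι b * a ∈ Set.range ι)
    (α : B → B) (hα : ∀ b : B, ι (α b) = a * ι b * a) :
    IsCenteredBernoulli (distribution ι E hE a) α := by
  have hι : Function.Injective ι := hE.injective
  have hα0 : α 0 = 0 := hι (by rw [hα, map_zero, mul_zero, zero_mul])
  intro n b
  change _ = ∑ π ∈ ncOneTwo n, jacobiTerm (fun _ => 0) (bernoulliMaps α) π b
  have hzero : ∀ π : Finpartition (Finset.range n),
      jacobiTerm (fun _ => 0) (bernoulliMaps α) π b ≠ 0 →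
        ∃ m, n = 2 * m ∧ IsIntervalPaired π 0 m := by
    intro π hne
    obtain ⟨m, hm, h⟩ := isIntervalPaired_of_jacobiSegment_ne_zero α π _ hα0 n 0 n rfl
      n.zero_le hne
    exact ⟨m, by omega, h⟩
  rcases Nat.even_or_odd n with hn | hn
  · obtain ⟨m, rfl⟩ := even_iff_exists_two_mul.1 hn
    rw [Finset.sum_eq_single_of_mem _ (intervalPairing_mem_ncOneTwo m)]
    · apply hι
      rw [ι_distribution_even ι E hE a haB, ← ncMonomial_range_nat,
        ← ι_jacobiSegment_bernoulli ι a α hα _ (fun i => b (Fin.ofNat (2 * m + 1) i)) m 0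
          (isIntervalPaired_intervalPairing m), zero_add]
      rfl
    · intro π hπ hne
      by_contra h
      obtain ⟨m', hm, hp⟩ := hzero π h
      obtain rfl : m = m' := by omega
      exact hne (eq_intervalPairing hπ hp)
  · rw [distribution_odd ι E hE a ha0 haB n hn]
    refine (Finset.sum_eq_zero fun π _ => ?_).symm
    by_contra h
    obtain ⟨m, rfl, -⟩ := hzero π h
    exact Nat.not_odd_iff_even.2 (even_two_mul m) hn

end Bernoulli

end OpFree

open OpFree in
theorem mainTheorem5 {A B : Type*}
    [CStarAlgebra A] [PartialOrder A] [StarOrderedRing A]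
    [CStarAlgebra B] [PartialOrder B] [StarOrderedRing B]
    (ι : B →⋆ₐ[ℂ] A) (E : A →ₗ[ℂ] B) (hE : IsCondExpectation ι E)
    (a : A) (ha0 : E a = 0) (haB : ∀ b : B, a * ι b * a ∈ Set.range ι)
    (α : B → B) (hα : ∀ b : B, ι (α b) = a * ι b * a) :
    (IsCenteredBernoulli (distribution ι E hE a) α ∧
      (IsSelfAdjoint a → ∃ φ : B →CP B, ∀ b, φ b = α b)) ∧
    (∀ (n : ℕ), ∀ π ∈ ncPair n, ∀ b : Fin (n + 1) → B,
      ι (jacobiTerm (fun _ => 0) (fun _ => α) π b) = ncMonomial ι a n b) ∧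
    (∀ t : ℝ, 1 ≤ t →
      (∃! ν : AlgDist B, IsFreeConvPower (distribution ι E hE a) t ν) ∧
      ∀ ν : AlgDist B, IsFreeConvPower (distribution ι E hE a) t ν →
        (∀ n : ℕ, Odd n → ∀ b : Fin (n + 1) → B, ν.mom n b = 0) ∧
        (∀ (n : ℕ) (b : Fin (2 * n + 1) → B),
          ι (ν.mom (2 * n) b) = (freeBinomialMoment n t : ℂ) • ncMonomial ι a (2 * n) b)) ∧
    (∀ n : ℕ, freeBinomialMoment n 2 = ((2 * n).choose n : ℝ)) := by
  refine ⟨⟨isCenteredBernoulli_distribution ι E hE a ha0 haB α hα,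
    fun ha => exists_completelyPositive ι hE.injective a ha α hα⟩,
    fun n π hπ b => ι_jacobiTerm_ncPair ι a α hα π hπ b, fun t ht => ?_,
    freeBinomialMoment_two⟩
  have ht0 : t ≠ 0 := by linarith
  have hpow := isFreeConvPower_distribution ι E hE a ha0 haB t ht0
  have huniq := existsUnique_isFreeConvPower hpow
  refine ⟨huniq, fun ν hν => ?_⟩
  -- By uniqueness $\nu$ is the explicit rescaling of $\mu_a$, whose moments are read off.
  obtain rfl := huniq.unique hpow hν
  refine ⟨fun n hn b => ?_, fun n b => ?_⟩
  · change symmetricMoment t n • (distribution ι E hE a).mom n b = _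
    rw [symmetricMoment_odd t n hn, zero_smul]
  · change ι (symmetricMoment t (2 * n) • (distribution ι E hE a).mom (2 * n) b) = _
    rw [map_smul, symmetricMoment_even, ι_distribution_even ι E hE a haB]
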